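/- Let $G$ be a connected graph with $n$ vertices. Each vertex is either active or inactive; in the starting state, the vertices are independently active with probability $\tfrac12$ and inactive with probability $\tfrac12$. At each time step an edge of $G$ is chosen uniformly at random, independently of everything that happened before; if at least one of its endpoints is active, then both endpoints become active, and otherwise nothing changes. (If $n=1$ there are no edges and the state never changes. This is the process in which each vertex has one of $m=2$ strategies and both endpoints of the chosen edge adopt the higher of their two strategies with probability $p=0$ and the lower with probability $1-p=1$, a vertex being active if it has the lower strategy.) Let $T_{V(G)}$ be the first time at which all vertices of $G$ are active, with $T_{V(G)}=0$ if all vertices are inactive in the starting state. Then $$\mathbb{E}\bigl[T_{V(G)}\bigr]<n^2\log n+n,$$ where $\log$ is the natural logarithm. -/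

import Mathlib

open MeasureTheory
open scoped ENNReal

/-- Both endpoints of the edge `e` adopt the strategy `c`; all other vertices keep theirs. -/
def adopt {V : Type*} [DecidableEq V] {m : ℕ} (s : V → Fin m) (e : Sym2 V) (c : Fin m) :
    V → Fin m :=
  fun v => if v ∈ e then c else s v

/-- One-step transition probability from `s` to `s'`: an edge `e` of `G` is chosen uniformly at
random, and both of its endpoints adopt the higher of their two strategies with probability `p`
and the lower with probability `1 - p`.  If `G` has no edges, the state does not change. -/
noncomputable def transitionProb {V : Type*} [Fintype V] [DecidableEq V] (G : SimpleGraph V)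
    [DecidableRel G.Adj] {m : ℕ} (p : unitInterval) (s s' : V → Fin m) : ℝ≥0∞ :=
  if G.edgeFinset.Nonempty then
    (∑ e ∈ G.edgeFinset,
      (ENNReal.ofReal (p : ℝ) * (if s' = adopt s e (e.map s).sup then 1 else 0)
        + ENNReal.ofReal (1 - (p : ℝ)) * (if s' = adopt s e (e.map s).inf then 1 else 0)))
      / (G.edgeFinset.card : ℝ≥0∞)
  else if s' = s then 1 else 0

/-- `S 0, S 1, …` is the pairwise interaction process on `G` with `m` strategies and parameter
`p`: the Markov chain on `V → Fin m` with transition probabilities `transitionProb G p`, in whose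
initial state the strategies of the vertices are independent and uniform (equivalently, the
initial state is uniform on the `m ^ |V|` states).  The strategies `1 < ⋯ < m` are the elements
of `Fin m` in order. -/
structure IsInteractionProcess {V : Type*} [Fintype V] [DecidableEq V] (G : SimpleGraph V)
    [DecidableRel G.Adj] {m : ℕ} (p : unitInterval) {Ω : Type*} [MeasurableSpace Ω]
    (μ : Measure Ω) (S : ℕ → Ω → V → Fin m) : Prop where
  measurable : ∀ t, Measurable (S t)
  law : ∀ (t : ℕ) (σ : ℕ → V → Fin m),
    μ {ω | ∀ i ≤ t, S i ω = σ i} =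
      (Fintype.card (V → Fin m) : ℝ≥0∞)⁻¹ *
        ∏ i ∈ Finset.range t, transitionProb G p (σ i) (σ (i + 1))

/-- With two strategies, a vertex is active if it plays the lower one (the one which always
prevails when `p = 0`), and inactive if it plays the higher one. -/
def IsActive {V : Type*} (s : V → Fin 2) (v : V) : Prop := s v = 0

open Classical in
/-- `T_U` along the trajectory `s`: the first time at which all vertices of `U` are active
(`⊤` if there is none), and `0` if all vertices of the graph are inactive at the start. -/
noncomputable def activationTime {V : Type*} (U : Set V) (s : ℕ → V → Fin 2) : ℕ∞ :=
  if ∀ v, ¬ IsActive (s 0) v then 0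
  else ⨅ t ∈ {t : ℕ | ∀ v ∈ U, IsActive (s t) v}, (t : ℕ∞)

/-! Let $M$ be the number of edges and $\lambda = 1 - 1/(2M)$. A set $R$ is inactive after a step
iff `dualStep e R` is inactive before it, so `inactiveProb` satisfies an averaging recursion in
which $R$ only grows. Connectedness supplies an edge that enlarges any proper nonempty $R$, whence
the bound $2^{-|R|}\lambda^t$ of `inactiveProb_le`. A union bound over vertices and summation over
$t$ then bound the expectation.

With only $\frac12\lambda^t$ per vertex the result is about $2M(\log n + 1 - \log 2)$, slightly too
large when $2M$ is near $n^2$. Two cases repair this. If at most $n/5$ vertices have degree at most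
1, the others satisfy the sharper bound of `inactiveProb_singleton_le`, essentially
$\frac13\lambda^t$, and the excess disappears. Otherwise $2M$ is at most about $\frac45 n^2$, and
the crude bound suffices. -/

/-- The effect on the state `s` of choosing the edge `e` when `p = 0`. -/
def interact {V : Type*} [DecidableEq V] {m : ℕ} (e : Sym2 V) (s : V → Fin m) : V → Fin m :=
  adopt s e (e.map s).inf

theorem sum_transitionProb_zero {V : Type*} [Fintype V] [DecidableEq V] (G : SimpleGraph V)
    [DecidableRel G.Adj] {m : ℕ} (hG : G.edgeFinset.Nonempty) (s : V → Fin m)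
    (H : Finset (V → Fin m)) :
    ∑ s' ∈ H, transitionProb G 0 s s' =
      (∑ e ∈ G.edgeFinset, if interact e s ∈ H then 1 else 0) / (G.edgeFinset.card : ℝ≥0∞) := by
  simp only [transitionProb, if_pos hG, div_eq_mul_inv]
  rw [← Finset.sum_mul, Finset.sum_comm]
  congr 1
  refine Finset.sum_congr rfl fun e _ => ?_
  simp only [ENNReal.ofReal_zero, zero_mul, sub_zero, ENNReal.ofReal_one, one_mul, zero_add,
    Set.Icc.coe_zero, Finset.sum_ite_eq', interact]
  congr

/-! ### The Markov property -/

section Markov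

variable {V : Type*} [Fintype V] [DecidableEq V] {G : SimpleGraph V} [DecidableRel G.Adj]
  {m : ℕ} {Ω : Type*} [MeasurableSpace Ω] {μ : Measure Ω} {S : ℕ → Ω → V → Fin m}

/-- Law of the trajectory up to time `t + 1` in terms of its law up to time `t`. -/
theorem IsInteractionProcess.measure_succ {p : unitInterval} (hS : IsInteractionProcess G p μ S)
    (t : ℕ) (σ : ℕ → V → Fin m) :
    μ {ω | ∀ i ≤ t + 1, S i ω = σ i} =
      μ {ω | ∀ i ≤ t, S i ω = σ i} * transitionProb G p (σ t) (σ (t + 1)) := by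
  rw [hS.law, hS.law, Finset.prod_range_succ, mul_assoc]

theorem IsInteractionProcess.measurableSet_preimage {p : unitInterval}
    (hS : IsInteractionProcess G p μ S) (t : ℕ) (H : Set (V → Fin m)) :
    MeasurableSet (S t ⁻¹' H) :=
  hS.measurable t H.toFinite.measurableSet

/-- The Markov property at time `t`, for events determined by `S 0` and `S (t + 1)`. -/
theorem IsInteractionProcess.measure_markov (hS : IsInteractionProcess G 0 μ S)
    (hG : G.edgeFinset.Nonempty) (t : ℕ) (D H : Set (V → Fin m)) :
    μ {ω | S 0 ω ∈ D ∧ S (t + 1) ω ∈ H} =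
      (∑ e ∈ G.edgeFinset, μ {ω | S 0 ω ∈ D ∧ interact e (S t ω) ∈ H})
        / (G.edgeFinset.card : ℝ≥0∞) := by
  classical
  set pre : Ω → Fin (t + 1) → V → Fin m := fun ω i => S i ω with hpre
  have hpm : Measurable pre := measurable_pi_lambda _ fun i => hS.measurable i
  set E : Finset (Fin (t + 1) → V → Fin m) := Finset.univ.filter fun π => π 0 ∈ D
  have hpair (π : Fin (t + 1) → V → Fin m) (s : V → Fin m) :
      μ ((fun ω => (pre ω, S (t + 1) ω)) ⁻¹' {(π, s)}) =
        μ (pre ⁻¹' {π}) * transitionProb G 0 (π (Fin.last t)) s := by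
    -- The law is stated for infinite sequences; only the entries up to `t + 1` matter, so `s`
    -- serves both as the last state and as padding.
    have h := hS.measure_succ t fun i => if h : i < t + 1 then π ⟨i, h⟩ else s
    have h1 : {ω | ∀ i ≤ t + 1, S i ω = if h : i < t + 1 then π ⟨i, h⟩ else s} =
        (fun ω => (pre ω, S (t + 1) ω)) ⁻¹' {(π, s)} := by
      ext ω
      simp only [Set.mem_ofPred_eq, Set.mem_preimage, Set.mem_singleton_iff, Prod.mk.injEq]
      constructor
      · intro h
        refine ⟨funext fun i => ?_, by simpa using h (t + 1) le_rfl⟩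
        have := h i i.2.le
        rwa [dif_pos i.2] at this
      · rintro ⟨h1, h2⟩ i hi
        split_ifs with hlt
        · rw [← h1]
        · obtain rfl : i = t + 1 := by omega
          exact h2
    have h2 : {ω | ∀ i ≤ t, S i ω = if h : i < t + 1 then π ⟨i, h⟩ else s} = pre ⁻¹' {π} := by
      ext ω
      simp only [Set.mem_ofPred_eq, Set.mem_preimage, Set.mem_singleton_iff]
      constructor
      · intro h
        refine funext fun i => ?_
        have := h i (Nat.lt_succ_iff.1 i.2)
        rwa [dif_pos i.2] at this
      · rintro h1 i hi
        rw [dif_pos (Nat.lt_succ_of_le hi), ← h1]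
    rw [h1, h2] at h
    simpa [Fin.last] using h
  have hL : {ω | S 0 ω ∈ D ∧ S (t + 1) ω ∈ H} =
      (fun ω => (pre ω, S (t + 1) ω)) ⁻¹' ↑(E ×ˢ H.toFinset) := by
    ext ω; simp [E, hpre]
  have hR (e : Sym2 V) : {ω | S 0 ω ∈ D ∧ interact e (S t ω) ∈ H} =
      pre ⁻¹' ↑(E.filter fun π => interact e (π (Fin.last t)) ∈ H.toFinset) := by
    ext ω; simp [E, hpre]
  simp_rw [hR, hL]
  rw [← sum_measure_preimage_singleton _
    fun y _ => (hpm.prodMk (hS.measurable (t + 1))) (measurableSet_singleton y)]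
  simp_rw [← sum_measure_preimage_singleton _ fun y _ => hpm (measurableSet_singleton y)]
  rw [Finset.sum_product]
  simp_rw [hpair, ← Finset.mul_sum, sum_transitionProb_zero G hG]
  simp_rw [Finset.sum_filter]
  rw [Finset.sum_comm, div_eq_mul_inv, Finset.sum_mul]
  refine Finset.sum_congr rfl fun π _ => ?_
  rw [div_eq_mul_inv, ← mul_assoc, Finset.mul_sum]
  simp

end Markov

/-! ### Duality: running the inactive set backwards -/

section Dual

variable {V : Type*} [DecidableEq V]

/-- The vertices that have to be inactive for `R` to be inactive after `e` is chosen. -/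
def dualStep (e : Sym2 V) (R : Finset V) : Finset V :=
  if ∃ v ∈ R, v ∈ e then R ∪ e.toFinset else R

theorem subset_dualStep (e : Sym2 V) (R : Finset V) : R ⊆ dualStep e R := by
  unfold dualStep
  split_ifs
  · exact Finset.subset_union_left
  · exact subset_rfl

theorem dualStep_mk_of_mem_of_notMem {R : Finset V} {x y : V} (hx : x ∈ R) (hy : y ∉ R) :
    dualStep s(x, y) R = insert y R := by
  rw [dualStep, if_pos ⟨x, hx, by simp⟩, Sym2.toFinset_mk_eq]
  ext z
  simp only [Finset.mem_union, Finset.mem_insert, Finset.mem_singleton]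
  constructor
  · rintro (h | rfl | rfl) <;> simp [*]
  · rintro (rfl | h) <;> simp [*]

theorem dualStep_of_forall_notMem {R : Finset V} {e : Sym2 V} (h : ∀ v ∈ e, v ∉ R) :
    dualStep e R = R :=
  if_neg fun ⟨v, hR, hv⟩ => h v hv hR

theorem dualStep_univ [Fintype V] (e : Sym2 V) : dualStep e (Finset.univ : Finset V) = .univ :=
  Finset.univ_subset_iff.1 (subset_dualStep _ _)

theorem isActive_interact_mk (x y : V) (s : V → Fin 2) (v : V) :
    IsActive (interact s(x, y) s) v ↔
      if v = x ∨ v = y then IsActive s x ∨ IsActive s y else IsActive s v := by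
  simp only [IsActive, interact, adopt, Sym2.mem_iff, Sym2.map_mk, Sym2.inf_mk]
  split_ifs
  · generalize s x = a
    generalize s y = b
    revert a b
    decide
  · rfl

/-- Inactivity of either endpoint after the step requires both endpoints to be inactive before it.
-/
theorem forall_not_isActive_interact (e : Sym2 V) (s : V → Fin 2) (R : Finset V) :
    (∀ v ∈ R, ¬ IsActive (interact e s) v) ↔ ∀ v ∈ dualStep e R, ¬ IsActive s v := by
  induction e with | _ x y
  simp only [isActive_interact_mk]
  by_cases h : ∃ v ∈ R, v ∈ s(x, y)
  · rw [dualStep, if_pos h]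
    simp only [Sym2.toFinset_mk_eq, Finset.mem_union, Finset.mem_insert, Finset.mem_singleton]
    obtain ⟨w, hwR, hw⟩ := h
    rw [Sym2.mem_iff] at hw
    constructor
    · intro h
      have h1 := h w hwR
      rw [if_pos hw, not_or] at h1
      rintro v (hv | rfl | rfl)
      · have h2 := h v hv
        split_ifs at h2 with h3
        · rcases h3 with rfl | rfl
          exacts [h1.1, h1.2]
        · exact h2
      exacts [h1.1, h1.2]
    · intro h v hv
      split_ifs
      · exact not_or.2 ⟨h x (by simp), h y (by simp)⟩
      · exact h v (Or.inl hv)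
  · rw [dualStep, if_neg h]
    push Not at h
    refine forall₂_congr fun v hv => ?_
    rw [if_neg]
    rintro h1
    exact h v hv (Sym2.mem_iff.2 h1)

end Dual

/-! ### Exponential decay of the inactivity probabilities -/

section Inactive

variable {V : Type*} [Fintype V] [DecidableEq V] {G : SimpleGraph V} [DecidableRel G.Adj]
  {Ω : Type*} [MeasurableSpace Ω] {μ : Measure Ω} {S : ℕ → Ω → V → Fin 2}

/-- The probability that at time `t` no vertex of `R` is active, although some vertex of the graph
was active at the start. -/
noncomputable def inactiveProb (μ : Measure Ω) (S : ℕ → Ω → V → Fin 2) (t : ℕ) (R : Finset V) : ℝ :=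
  μ.real {ω | (∃ v, IsActive (S 0 ω) v) ∧ ∀ v ∈ R, ¬ IsActive (S t ω) v}

theorem inactiveProb_zero_le [IsProbabilityMeasure μ] (hS : IsInteractionProcess G 0 μ S)
    (R : Finset V) : inactiveProb μ S 0 R ≤ (1 / 2) ^ R.card := by
  have hcard : (Fintype.card (V → Fin 2) : ℝ≥0∞) = 2 ^ Fintype.card V := by simp
  have hsing (s : V → Fin 2) : μ (S 0 ⁻¹' {s}) = (2 ^ Fintype.card V : ℝ≥0∞)⁻¹ := by
    have := hS.law 0 fun _ => s
    rw [hcard] at this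
    simpa [Set.preimage] using this
  set F : Finset (V → Fin 2) := Fintype.piFinset fun v => if v ∈ R then {1} else Finset.univ
  have hF : F.card * 2 ^ R.card = 2 ^ Fintype.card V := by
    have h1 : F.card = 2 ^ (Finset.univ \ R).card := by
      rw [Fintype.card_piFinset, Finset.card_eq_sum_ones, ← Finset.prod_pow_eq_pow_sum,
        ← Finset.prod_subset (Finset.subset_univ (Finset.univ \ R))]
      · refine Finset.prod_congr rfl fun v hv => ?_
        rw [if_neg (Finset.mem_sdiff.1 hv).2]
        simp
      · intro v _ hv
        rw [if_pos (by simpa using hv)]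
        simp
    rw [h1, ← pow_add, Finset.card_sdiff_add_card_eq_card (Finset.subset_univ _), Finset.card_univ]
  have hsub : {ω | (∃ v, IsActive (S 0 ω) v) ∧ ∀ v ∈ R, ¬ IsActive (S 0 ω) v} ⊆ S 0 ⁻¹' F := by
    rintro ω ⟨-, h⟩
    simp only [F, Set.mem_preimage, Finset.mem_coe, Fintype.mem_piFinset]
    intro v
    split_ifs with hv
    · have := h v hv
      simp only [IsActive] at this
      simp only [Finset.mem_singleton]
      omega
    · simp
  refine (measureReal_mono hsub).trans_eq ?_
  rw [measureReal_def, ← sum_measure_preimage_singleton _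
    fun y _ => hS.measurableSet_preimage 0 {y}]
  simp only [hsing, Finset.sum_const, nsmul_eq_mul, ENNReal.toReal_mul, ENNReal.toReal_natCast,
    ENNReal.toReal_inv, ENNReal.toReal_pow, ENNReal.toReal_ofNat, one_div, inv_pow]
  have : (F.card : ℝ) * 2 ^ R.card = 2 ^ Fintype.card V := by exact_mod_cast hF
  rw [← this]
  have hpos : (F.card : ℝ) ≠ 0 := by
    rintro h
    rw [h, zero_mul] at this
    exact (pow_pos two_pos _).ne this
  field_simp

theorem inactiveProb_succ [IsProbabilityMeasure μ] (hS : IsInteractionProcess G 0 μ S)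
    (hG : G.edgeFinset.Nonempty) (t : ℕ) (R : Finset V) :
    inactiveProb μ S (t + 1) R =
      (∑ e ∈ G.edgeFinset, inactiveProb μ S t (dualStep e R)) / (G.edgeFinset.card : ℝ) := by
  have h := hS.measure_markov hG t {s | ∃ v, IsActive s v} {s | ∀ v ∈ R, ¬ IsActive s v}
  simp only [Set.mem_ofPred_eq, forall_not_isActive_interact] at h
  simp only [inactiveProb, measureReal_def]
  rw [h, ENNReal.toReal_div, ENNReal.toReal_sum fun _ _ => measure_ne_top _ _,
    ENNReal.toReal_natCast]

/-- Active vertices never die out. This is where excluding the all-inactive start matters. -/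
theorem inactiveProb_univ [IsProbabilityMeasure μ] (hS : IsInteractionProcess G 0 μ S)
    (hG : G.edgeFinset.Nonempty) (t : ℕ) : inactiveProb μ S t Finset.univ = 0 := by
  induction t with
  | zero =>
    have : {ω | (∃ v, IsActive (S 0 ω) v) ∧ ∀ v ∈ Finset.univ, ¬ IsActive (S 0 ω) v} = ∅ := by
      ext ω
      simp
    rw [inactiveProb, this, measureReal_empty]
  | succ t ih => simp [inactiveProb_succ hS hG, dualStep_univ, ih]

theorem exists_mem_edgeFinset_dualStep (hG : G.Connected) {R : Finset V} (hR : R.Nonempty)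
    (hR' : R ≠ Finset.univ) :
    ∃ e ∈ G.edgeFinset, (dualStep e R).card = R.card + 1 := by
  obtain ⟨x, hx⟩ := hR
  obtain ⟨y, hy⟩ : ∃ y, y ∉ R := by
    by_contra! h
    exact hR' (Finset.eq_univ_iff_forall.2 h)
  obtain ⟨p⟩ := hG.preconnected x y
  obtain ⟨d, -, h1, h2⟩ := p.exists_boundary_dart (R : Set V) hx hy
  refine ⟨s(d.fst, d.snd), by simp, ?_⟩
  rw [dualStep_mk_of_mem_of_notMem h1 h2, Finset.card_insert_of_notMem h2]

/-- In the recursion, one edge out of $M$ adds a vertex and gains a factor $\frac12$, and the others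
lose nothing: $(M - 1 + \frac12)/M = \lambda$. -/
theorem inactiveProb_le [IsProbabilityMeasure μ] (hS : IsInteractionProcess G 0 μ S)
    (hG : G.Connected) (hE : G.edgeFinset.Nonempty) (t : ℕ) {R : Finset V} (hR : R.Nonempty) :
    inactiveProb μ S t R ≤ (1 / 2) ^ R.card * (1 - 1 / (2 * G.edgeFinset.card : ℝ)) ^ t := by
  have hm : (1 : ℝ) ≤ G.edgeFinset.card := by exact_mod_cast hE.card_pos
  set M : ℝ := (G.edgeFinset.card : ℝ) with hM
  have hlam : 0 ≤ 1 - 1 / (2 * M) := by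
    rw [sub_nonneg, div_le_one (by positivity)]
    linarith
  induction t generalizing R with
  | zero => simpa using inactiveProb_zero_le hS R
  | succ t ih =>
    set L := (1 - 1 / (2 * M)) ^ t with hL
    have hL0 : 0 ≤ L := by positivity
    by_cases hR' : R = Finset.univ
    · rw [hR', inactiveProb_univ hS hE]
      positivity
    obtain ⟨e, he, hcard⟩ := exists_mem_edgeFinset_dualStep hG hR hR'
    rw [inactiveProb_succ hS hE, ← Finset.add_sum_erase _ _ he, div_le_iff₀ (by positivity)]
    have h1 := ih (hR.mono (subset_dualStep e R))
    rw [hcard] at h1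
    have h2 : ∑ e' ∈ G.edgeFinset.erase e, inactiveProb μ S t (dualStep e' R) ≤
        (M - 1) * ((1 / 2) ^ R.card * L) := by
      refine (Finset.sum_le_card_nsmul _ _ ((1 / 2) ^ R.card * L) fun e' _ => ?_).trans_eq ?_
      · refine (ih (hR.mono (subset_dualStep e' R))).trans ?_
        refine mul_le_mul_of_nonneg_right ?_ hL0
        exact pow_le_pow_of_le_one (by norm_num) (by norm_num)
          (Finset.card_le_card (subset_dualStep e' R))
      · rw [Finset.card_erase_of_mem he, nsmul_eq_mul, Nat.cast_sub hE.card_pos, Nat.cast_one]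
    refine (add_le_add h1 h2).trans_eq ?_
    rw [pow_succ (1 / 2 : ℝ), pow_succ _ t, ← hL]
    field_simp
    ring

theorem card_incident_eq_degree (v : V) :
    (G.edgeFinset.filter fun e => v ∈ e).card = G.degree v := by
  rw [← G.incidenceFinset_eq_filter, G.card_incidenceFinset_eq_degree]

/-- Each of the $d$ edges at `v` turns `{v}` into a pair, bounded by $\frac14\lambda^t$; the other
edges leave `{v}` alone. For $d = 2$ the resulting linear recursion with initial value $\frac12$ has
exactly the stated right-hand side as solution. -/
theorem inactiveProb_singleton_le [IsProbabilityMeasure μ] (hS : IsInteractionProcess G 0 μ S)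
    (hG : G.Connected) (t : ℕ) {v : V} (hv : 2 ≤ G.degree v) :
    inactiveProb μ S t {v} ≤ 1 / 3 * (1 - 1 / (2 * G.edgeFinset.card : ℝ)) ^ t +
      1 / 6 * (1 - 2 / (G.edgeFinset.card : ℝ)) ^ t := by
  have hdm : G.degree v ≤ G.edgeFinset.card := by
    rw [← card_incident_eq_degree]
    exact Finset.card_filter_le _ _
  have hE : G.edgeFinset.Nonempty := Finset.card_pos.1 (by omega)
  have hm : (2 : ℝ) ≤ G.edgeFinset.card := by exact_mod_cast hv.trans hdm
  have hd : (2 : ℝ) ≤ G.degree v := by exact_mod_cast hv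
  have hdm' : (G.degree v : ℝ) ≤ G.edgeFinset.card := by exact_mod_cast hdm
  have hc := card_incident_eq_degree (G := G) v
  have hc' := Finset.card_filter_add_card_filter_not (s := G.edgeFinset) (fun e => v ∈ e)
  rw [hc] at hc'
  have hc'' : ((G.edgeFinset.filter fun e => v ∉ e).card : ℝ) = G.edgeFinset.card - G.degree v := by
    rw [← hc']
    push_cast
    ring
  set M : ℝ := (G.edgeFinset.card : ℝ) with hM
  set d : ℝ := (G.degree v : ℝ)
  have hlam : 0 ≤ 1 - 1 / (2 * M) := by
    rw [sub_nonneg, div_le_one (by positivity)]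
    linarith
  have hrho : 0 ≤ 1 - 2 / M := by
    rw [sub_nonneg, div_le_one (by positivity)]
    linarith
  induction t with
  | zero =>
    have := inactiveProb_zero_le hS {v}
    norm_num at this ⊢
    linarith
  | succ t ih =>
    set A := (1 - 1 / (2 * M)) ^ t with hA
    set B := (1 - 2 / M) ^ t with hB
    have hA0 : 0 ≤ A := by positivity
    have hB0 : 0 ≤ B := by positivity
    rw [inactiveProb_succ hS hE, div_le_iff₀ (by positivity),
      ← Finset.sum_filter_add_sum_filter_not G.edgeFinset fun e => v ∈ e]
    have h1 : ∑ e ∈ G.edgeFinset with v ∈ e, inactiveProb μ S t (dualStep e {v}) ≤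
        d * (1 / 4 * A) := by
      refine (Finset.sum_le_card_nsmul _ _ (1 / 4 * A) fun e he => ?_).trans_eq ?_
      · obtain ⟨he, hve⟩ := Finset.mem_filter.1 he
        refine (inactiveProb_le hS hG hE t ⟨v, subset_dualStep _ _ (by simp)⟩).trans_eq ?_
        obtain ⟨w, rfl⟩ := Sym2.mem_iff_exists.1 hve
        have hw : v ≠ w := (G.mem_edgeFinset.1 he).ne
        rw [dualStep_mk_of_mem_of_notMem (by simp) (by simpa using hw.symm),
          Finset.card_insert_of_notMem (by simpa using hw.symm), Finset.card_singleton]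
        norm_num [hA, hM]
      · rw [hc, nsmul_eq_mul]
    have h2 : ∑ e ∈ G.edgeFinset with v ∉ e, inactiveProb μ S t (dualStep e {v}) ≤
        (M - d) * (1 / 3 * A + 1 / 6 * B) := by
      refine (Finset.sum_le_card_nsmul _ _ (1 / 3 * A + 1 / 6 * B) fun e he => ?_).trans_eq ?_
      · rw [dualStep_of_forall_notMem]
        · exact ih
        · intro w hw hwv
          rw [Finset.mem_singleton.1 hwv] at hw
          exact (Finset.mem_filter.1 he).2 hw
      · rw [nsmul_eq_mul, hc'']
    refine (add_le_add h1 h2).trans ?_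
    have e1 : (1 / 3 * (1 - 1 / (2 * M)) ^ (t + 1) + 1 / 6 * (1 - 2 / M) ^ (t + 1)) * M =
        1 / 3 * A * (M - 1 / 2) + 1 / 6 * B * (M - 2) := by
      rw [pow_succ, pow_succ, ← hA, ← hB]
      field_simp
    rw [e1]
    nlinarith [mul_nonneg hA0 (sub_nonneg.2 hd), mul_nonneg hB0 (sub_nonneg.2 hd)]

end Inactive

/-! ### From tail bounds to the expectation -/

theorem tsum_le_of_le_geometric {f : ℕ → ℝ≥0∞} {a b r : ℝ} (ha : 0 ≤ a) (hb : 0 ≤ b) (hr : 0 ≤ r)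
    (hr1 : r < 1) (hf1 : ∀ t, f t ≤ 1) (hf : ∀ t, f t ≤ ENNReal.ofReal (a * r ^ t + b * (r ^ 4) ^ t))
    (K : ℕ) :
    ∑' t, f t ≤ ENNReal.ofReal (K + (a * r ^ K + b * (r ^ K) ^ 4) / (1 - r)) := by
  have hg : HasSum (fun t => (a * r ^ K + b * (r ^ K) ^ 4) * r ^ t)
      ((a * r ^ K + b * (r ^ K) ^ 4) / (1 - r)) := by
    rw [div_eq_mul_inv]
    exact (hasSum_geometric_of_lt_one hr hr1).mul_left _
  rw [← ENNReal.summable.sum_add_tsum_nat_add' (k := K),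
    ENNReal.ofReal_add (by positivity) (div_nonneg (by positivity) (by linarith)), ← hg.tsum_eq,
    ENNReal.ofReal_tsum_of_nonneg (fun t => by positivity) hg.summable]
  refine add_le_add ?_ (ENNReal.tsum_le_tsum fun t => (hf _).trans (ENNReal.ofReal_le_ofReal ?_))
  · refine (Finset.sum_le_sum fun t _ => hf1 t).trans ?_
    simp
  · have h1 : (r ^ 4) ^ (t + K) ≤ (r ^ K) ^ 4 * r ^ t := by
      have : (r ^ 4) ^ (t + K) = (r ^ K) ^ 4 * (r ^ t) ^ 4 := by ring
      rw [this]
      refine mul_le_mul_of_nonneg_left ?_ (by positivity)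
      exact pow_le_of_le_one (by positivity) (pow_le_one₀ hr hr1.le) (by norm_num)
    have h2 : a * r ^ (t + K) = a * r ^ K * r ^ t := by ring
    nlinarith [mul_le_mul_of_nonneg_left h1 hb]

theorem tsum_le_of_le_exp {f : ℕ → ℝ≥0∞} {a b M L : ℝ} (ha : 0 ≤ a) (hb : 0 ≤ b) (hM : 1 ≤ M)
    (hL : 0 ≤ L) (hf1 : ∀ t, f t ≤ 1)
    (hf : ∀ t, f t ≤ ENNReal.ofReal
      (a * (1 - 1 / (2 * M)) ^ t + b * ((1 - 1 / (2 * M)) ^ 4) ^ t)) :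
    ∑' t, f t ≤ ENNReal.ofReal
      (2 * M * L + 1 + 2 * M * (a * Real.exp (-L) + b * Real.exp (-L) ^ 4)) := by
  have hr : 0 ≤ 1 - 1 / (2 * M) := by
    rw [sub_nonneg, div_le_one (by positivity)]
    linarith
  have hr1 : 1 - 1 / (2 * M) < 1 := by
    -- Strictness makes the geometric tail summable.
    have : 0 < 1 / (2 * M) := by positivity
    linarith
  -- Up to the cutoff each term is bounded by 1; the cutoff makes $\lambda^K \le e^{-L}$, and
  -- rounding up costs the `+ 1`.
  refine (tsum_le_of_le_geometric ha hb hr hr1 hf1 hf ⌈2 * M * L⌉₊).trans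
    (ENNReal.ofReal_le_ofReal ?_)
  have hK := Nat.ceil_lt_add_one (a := 2 * M * L) (by positivity)
  have hK' := Nat.le_ceil (2 * M * L)
  set K := ⌈2 * M * L⌉₊
  have hexp : (1 - 1 / (2 * M)) ^ K ≤ Real.exp (-L) := by
    refine (pow_le_pow_left₀ hr (Real.one_sub_le_exp_neg _) K).trans ?_
    rw [← Real.exp_nat_mul, Real.exp_le_exp, mul_neg, neg_le_neg_iff, mul_one_div,
      le_div_iff₀ (by positivity)]
    linarith
  have e : (1 : ℝ) - (1 - 1 / (2 * M)) = (2 * M)⁻¹ := by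
    rw [sub_sub_cancel, one_div]
  rw [e, div_inv_eq_mul, mul_comm _ (2 * M)]
  gcongr

theorem coe_activationTime_univ_le_tsum {V : Type*} (s : ℕ → V → Fin 2) :
    (activationTime Set.univ s : ℝ≥0∞) ≤
      ∑' t, {t : ℕ | (∃ v, IsActive (s 0) v) ∧ ∃ v, ¬ IsActive (s t) v}.indicator 1 t := by
  classical
  unfold activationTime
  split_ifs with h
  · simp
  push Not at h
  simp only [h, true_and]
  by_cases hall : ∃ t, ∀ v, IsActive (s t) v
  · have hle : (⨅ t ∈ {t : ℕ | ∀ v ∈ Set.univ, IsActive (s t) v}, (t : ℕ∞)) ≤ Nat.find hall :=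
      iInf₂_le (Nat.find hall) fun v _ => Nat.find_spec hall v
    refine (ENat.toENNReal_le.2 hle).trans ?_
    refine le_trans ?_ (ENNReal.sum_le_tsum (Finset.range (Nat.find hall)))
    rw [Finset.sum_congr rfl (g := fun _ => (1 : ℝ≥0∞))]
    · simp
    · intro t ht
      have := Nat.find_min hall (Finset.mem_range.1 ht)
      push Not at this
      exact Set.indicator_of_mem (s := {t : ℕ | ∃ v, ¬ IsActive (s t) v}) this 1
  · push Not at hall
    have : {t : ℕ | ∃ v, ¬ IsActive (s t) v} = Set.univ := Set.eq_univ_of_forall hall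
    rw [this, Set.indicator_univ]
    simp

theorem measure_exists_not_isActive_le {V : Type*} [Fintype V] {Ω : Type*} [MeasurableSpace Ω]
    {μ : Measure Ω} [IsProbabilityMeasure μ] {S : ℕ → Ω → V → Fin 2} (t : ℕ) :
    μ {ω | (∃ v, IsActive (S 0 ω) v) ∧ ∃ v, ¬ IsActive (S t ω) v} ≤
      ENNReal.ofReal (∑ v, inactiveProb μ S t {v}) := by
  rw [← ofReal_measureReal]
  refine ENNReal.ofReal_le_ofReal (le_trans
    (measureReal_mono ?_ (measure_ne_top μ _)) (measureReal_biUnion_finset_le Finset.univ _))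
  rintro ω ⟨h, v, hv⟩
  exact Set.mem_biUnion (Finset.mem_coe.2 (Finset.mem_univ v)) ⟨h, by simpa using hv⟩

section

variable {V : Type*} [Fintype V] [DecidableEq V] {G : SimpleGraph V} [DecidableRel G.Adj]
  {Ω : Type*} [MeasurableSpace Ω] {μ : Measure Ω} {S : ℕ → Ω → V → Fin 2}

theorem lintegral_activationTime_le_tsum {p : unitInterval} (hS : IsInteractionProcess G p μ S) :
    ∫⁻ ω, (activationTime (Set.univ : Set V) (fun t => S t ω) : ℝ≥0∞) ∂μ ≤
      ∑' t, μ {ω | (∃ v, IsActive (S 0 ω) v) ∧ ∃ v, ¬ IsActive (S t ω) v} := by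
  have hmeas (t : ℕ) :
      MeasurableSet {ω | (∃ v, IsActive (S 0 ω) v) ∧ ∃ v, ¬ IsActive (S t ω) v} :=
    (hS.measurableSet_preimage 0 {s | ∃ v, IsActive s v}).inter
      (hS.measurableSet_preimage t {s | ∃ v, ¬ IsActive s v})
  refine (lintegral_mono fun ω => coe_activationTime_univ_le_tsum fun t => S t ω).trans_eq ?_
  simp_rw [← lintegral_indicator_one (hmeas _)]
  rw [← lintegral_tsum fun t => (measurable_one.indicator (hmeas t)).aemeasurable]
  rfl

theorem sum_inactiveProb_singleton_le [IsProbabilityMeasure μ] (hS : IsInteractionProcess G 0 μ S)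
    (hG : G.Connected) (hE : G.edgeFinset.Nonempty) (t : ℕ) :
    ∑ v, inactiveProb μ S t {v} ≤
      Fintype.card V / 2 * (1 - 1 / (2 * G.edgeFinset.card : ℝ)) ^ t := by
  refine (Finset.sum_le_card_nsmul _ _ (1 / 2 * (1 - 1 / (2 * G.edgeFinset.card : ℝ)) ^ t)
    fun v _ => ?_).trans_eq ?_
  · simpa using inactiveProb_le hS hG hE t (Finset.singleton_nonempty v)
  · rw [nsmul_eq_mul, Finset.card_univ]
    ring

/-- The worst case has $n/5$ vertices of degree at most 1: $\frac15\cdot\frac12 +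
\frac45\cdot\frac13 = \frac{11}{30}$. -/
theorem sum_inactiveProb_singleton_le_of_card [IsProbabilityMeasure μ]
    (hS : IsInteractionProcess G 0 μ S) (hG : G.Connected) (hE : G.edgeFinset.Nonempty)
    (hl : 5 * (Finset.univ.filter fun v => G.degree v ≤ 1).card ≤ Fintype.card V) (t : ℕ) :
    ∑ v, inactiveProb μ S t {v} ≤
      11 / 30 * Fintype.card V * (1 - 1 / (2 * G.edgeFinset.card : ℝ)) ^ t +
        Fintype.card V / 6 * ((1 - 1 / (2 * G.edgeFinset.card : ℝ)) ^ 4) ^ t := by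
  have hm : (1 : ℝ) ≤ G.edgeFinset.card := by exact_mod_cast hE.card_pos
  have hl' : 5 * ((Finset.univ.filter fun v => G.degree v ≤ 1).card : ℝ) ≤ Fintype.card V := by
    exact_mod_cast hl
  have hc := Finset.card_filter_add_card_filter_not (s := Finset.univ) fun v => G.degree v ≤ 1
  have hc' : ((Finset.univ.filter fun v => ¬ G.degree v ≤ 1).card : ℝ) =
      Fintype.card V - (Finset.univ.filter fun v => G.degree v ≤ 1).card := by
    rw [← Finset.card_univ, ← hc]
    push_cast
    ring
  set l : ℝ := ((Finset.univ.filter fun v => G.degree v ≤ 1).card : ℝ)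
  set M : ℝ := (G.edgeFinset.card : ℝ) with hM
  have hr : 0 ≤ 1 - 1 / (2 * M) := by
    rw [sub_nonneg, div_le_one (by positivity)]
    linarith
  set A := (1 - 1 / (2 * M)) ^ t with hA
  set B := ((1 - 1 / (2 * M)) ^ 4) ^ t with hB
  have hA0 : 0 ≤ A := by positivity
  have hB0 : 0 ≤ B := by positivity
  have h1 : ∑ v with G.degree v ≤ 1, inactiveProb μ S t {v} ≤ l * (1 / 2 * A) := by
    refine (Finset.sum_le_card_nsmul _ _ (1 / 2 * A) fun v _ => ?_).trans_eq (nsmul_eq_mul _ _)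
    simpa only [Finset.card_singleton, pow_one] using
      inactiveProb_le hS hG hE t (Finset.singleton_nonempty v)
  have h2 : ∑ v with ¬ G.degree v ≤ 1, inactiveProb μ S t {v} ≤
      (Fintype.card V - l) * (1 / 3 * A + 1 / 6 * B) := by
    refine (Finset.sum_le_card_nsmul _ _ (1 / 3 * A + 1 / 6 * B) fun v hv => ?_).trans_eq ?_
    · have hv2 : 2 ≤ G.degree v := not_le.1 (Finset.mem_filter.1 hv).2
      have hM2 : 2 ≤ M := by
        rw [hM, ← Nat.cast_ofNat, Nat.cast_le]
        refine hv2.trans ?_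
        rw [← card_incident_eq_degree]
        exact Finset.card_filter_le _ _
      refine (inactiveProb_singleton_le hS hG t hv2).trans ?_
      rw [← hM, ← hA]
      have : (1 - 2 / M) ^ t ≤ B := by
        refine pow_le_pow_left₀ ?_ ?_ t
        · rw [sub_nonneg, div_le_one (by positivity)]
          exact hM2
        -- Bernoulli: $1 - 2/M \le \lambda^4$.
        · have := one_add_mul_le_pow (a := -(1 / (2 * M))) (by linarith) 4
          refine le_of_eq_of_le ?_ this
          field_simp
          norm_num
          ring
      linarith
    · rw [nsmul_eq_mul, hc']
  rw [← Finset.sum_filter_add_sum_filter_not _ fun v => G.degree v ≤ 1]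
  have hl0 : 0 ≤ l := by positivity
  refine (add_le_add h1 h2).trans ?_
  nlinarith [mul_nonneg hA0 (sub_nonneg.2 hl'), mul_nonneg hB0 hl0]

theorem lintegral_activationTime_le [IsProbabilityMeasure μ] (hS : IsInteractionProcess G 0 μ S)
    (hE : G.edgeFinset.Nonempty) {a b L : ℝ} (ha : 0 ≤ a) (hb : 0 ≤ b) (hL : 0 ≤ L)
    (h : ∀ t, ∑ v, inactiveProb μ S t {v} ≤ a * (1 - 1 / (2 * G.edgeFinset.card : ℝ)) ^ t +
        b * ((1 - 1 / (2 * G.edgeFinset.card : ℝ)) ^ 4) ^ t) :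
    ∫⁻ ω, (activationTime (Set.univ : Set V) (fun t => S t ω) : ℝ≥0∞) ∂μ ≤
      ENNReal.ofReal (2 * G.edgeFinset.card * L + 1 +
        2 * G.edgeFinset.card * (a * Real.exp (-L) + b * Real.exp (-L) ^ 4)) :=
  (lintegral_activationTime_le_tsum hS).trans <|
    tsum_le_of_le_exp ha hb (by exact_mod_cast hE.card_pos) hL (fun _ => prob_le_one) fun t =>
      (measure_exists_not_isActive_le t).trans (ENNReal.ofReal_le_ofReal (h t))

end

/-! ### Bounds on the number of edges -/

section

variable {V : Type*} [Fintype V] {G : SimpleGraph V} [DecidableRel G.Adj]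

theorem two_mul_card_edgeFinset_le :
    2 * (G.edgeFinset.card : ℝ) ≤ (Fintype.card V : ℝ) ^ 2 - Fintype.card V := by
  have h := G.card_edgeFinset_le_card_choose_two
  have h2 : (G.edgeFinset.card : ℝ) ≤ (Fintype.card V).choose 2 := by exact_mod_cast h
  rw [Nat.cast_choose_two] at h2
  linarith

theorem two_mul_card_edgeFinset_le_of_card [Nonempty V]
    (hl : Fintype.card V < 5 * (Finset.univ.filter fun v => G.degree v ≤ 1).card)
    (hn : 2 ≤ Fintype.card V) :
    2 * (G.edgeFinset.card : ℝ) ≤ 4 / 5 * (Fintype.card V : ℝ) ^ 2 - 3 / 5 * Fintype.card V := by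
  have hs : ∑ v, (G.degree v : ℝ) = 2 * G.edgeFinset.card := by
    exact_mod_cast G.sum_degrees_eq_twice_card_edges
  have hc := Finset.card_filter_add_card_filter_not (s := Finset.univ) fun v => G.degree v ≤ 1
  have hc' : ((Finset.univ.filter fun v => ¬ G.degree v ≤ 1).card : ℝ) =
      Fintype.card V - (Finset.univ.filter fun v => G.degree v ≤ 1).card := by
    rw [← Finset.card_univ, ← hc]
    push_cast
    ring
  have hl' : (Fintype.card V : ℝ) < 5 * (Finset.univ.filter fun v => G.degree v ≤ 1).card := by
    exact_mod_cast hl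
  have hn' : (2 : ℝ) ≤ Fintype.card V := by exact_mod_cast hn
  have h1 : ∑ v with G.degree v ≤ 1, (G.degree v : ℝ) ≤
      (Finset.univ.filter fun v => G.degree v ≤ 1).card := by
    refine (Finset.sum_le_card_nsmul _ _ 1 fun v hv => ?_).trans_eq (by simp)
    exact_mod_cast (Finset.mem_filter.1 hv).2
  have h2 : ∑ v with ¬ G.degree v ≤ 1, (G.degree v : ℝ) ≤
      (Finset.univ.filter fun v => ¬ G.degree v ≤ 1).card * ((Fintype.card V : ℝ) - 1) := by
    refine (Finset.sum_le_card_nsmul _ _ ((Fintype.card V : ℝ) - 1) fun v _ => ?_).trans_eq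
      (by simp)
    have := G.degree_lt_card_verts v
    rw [le_sub_iff_add_le]
    exact_mod_cast this
  rw [← hs, ← Finset.sum_filter_add_sum_filter_not _ fun v => G.degree v ≤ 1]
  rw [hc'] at h2
  -- With $l$ vertices of degree at most 1, the degree sum is at most $n(n-1) - l(n-2)$; then use $l
  -- > n/5$.
  nlinarith [mul_nonneg (sub_nonneg.2 hl'.le) (sub_nonneg.2 hn')]

end

/-! ### Assembling the two cases -/

theorem mainTheorem3 {V : Type*} [Fintype V] [DecidableEq V] (G : SimpleGraph V)
    [DecidableRel G.Adj] (hG : G.Connected)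
    {Ω : Type*} [MeasurableSpace Ω] (μ : Measure Ω) [IsProbabilityMeasure μ]
    (S : ℕ → Ω → V → Fin 2) (hS : IsInteractionProcess G 0 μ S) :
    ∫⁻ ω, (activationTime (Set.univ : Set V) (fun t => S t ω) : ℝ≥0∞) ∂μ
      < ENNReal.ofReal
          ((Fintype.card V : ℝ) ^ 2 * Real.log (Fintype.card V : ℝ) + (Fintype.card V : ℝ)) := by
  have := hG.nonempty
  rcases (Nat.succ_le_of_lt (Fintype.card_pos (α := V))).eq_or_lt with hn | hn
  · have hsub : Subsingleton V := Fintype.card_le_one_iff_subsingleton.1 hn.ge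
    have h0 (s : ℕ → V → Fin 2) : activationTime Set.univ s = 0 := by
      unfold activationTime
      split_ifs with h
      · rfl
      · push Not at h
        obtain ⟨v, hv⟩ := h
        refine nonpos_iff_eq_zero.1 (iInf₂_le 0 fun w _ => ?_)
        rwa [Subsingleton.elim w v]
    simp [h0, ← hn]
  have hn2 : 2 ≤ Fintype.card V := hn
  obtain ⟨v₀⟩ := hG.nonempty
  obtain ⟨e, he, -⟩ := exists_mem_edgeFinset_dualStep hG (Finset.singleton_nonempty v₀) (by
    intro h
    rw [← Finset.card_univ, ← h, Finset.card_singleton] at hn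
    exact lt_irrefl _ hn)
  have hE : G.edgeFinset.Nonempty := ⟨e, he⟩
  have hM0 : (0 : ℝ) ≤ 2 * (G.edgeFinset.card : ℝ) := by positivity
  have hM := two_mul_card_edgeFinset_le (G := G)
  set n : ℝ := (Fintype.card V : ℝ) with hn_def
  have hn2' : (2 : ℝ) ≤ n := Nat.ofNat_le_cast.2 hn2
  have hn0 : 0 < n := by linarith
  have hlog2 := Real.log_two_gt_d9
  have hlogn : Real.log 2 ≤ Real.log n := Real.log_le_log two_pos hn2'
  by_cases hl : 5 * (Finset.univ.filter fun v => G.degree v ≤ 1).card ≤ Fintype.card V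
  · have hn3 : (3 : ℝ) ≤ n := by
      rcases hn2.eq_or_lt with h | h
      · have : (Finset.univ.filter fun v => G.degree v ≤ 1) = Finset.univ := by
          refine Finset.filter_true_of_mem fun v _ => ?_
          have := G.degree_lt_card_verts v
          omega
        rw [this, Finset.card_univ] at hl
        omega
      · exact Nat.ofNat_le_cast.2 h
    have hexp := Real.exp_one_lt_d9
    have hlog1 : 1 ≤ Real.log n := by
      rw [Real.le_log_iff_exp_le hn0]
      linarith
    -- For $L = \log n - 1$ the main tail term is $\frac{11}{30}e < 1$, so it is absorbed by the
    -- $-1$ in $L$; this is why the threshold $\frac15$ works.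
    have hL : Real.exp (-(Real.log n - 1)) = Real.exp 1 / n := by
      rw [neg_sub, Real.exp_sub, Real.exp_log hn0]
    refine (lintegral_activationTime_le hS hE (by positivity) (by positivity) (sub_nonneg.2 hlog1)
      (sum_inactiveProb_singleton_le_of_card hS hG hE hl)).trans_lt ?_
    rw [hL, ENNReal.ofReal_lt_ofReal_iff (by positivity), ← hn_def]
    have h1 : 11 / 30 * n * (Real.exp 1 / n) ≤ 1 := by
      rw [mul_assoc, mul_div_cancel₀ _ hn0.ne']
      linarith
    have h2 : n / 6 * (Real.exp 1 / n) ^ 4 ≤ 10 / n ^ 3 := by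
      have h4 : Real.exp 1 ^ 4 ≤ 60 :=
        (pow_le_pow_left₀ (Real.exp_pos 1).le hexp.le 4).trans (by norm_num)
      have : n / 6 * (Real.exp 1 / n) ^ 4 = Real.exp 1 ^ 4 / 6 / n ^ 3 := by
        field_simp
      rw [this]
      gcongr
      linarith
    have h3 : 2 * (G.edgeFinset.card : ℝ) * (10 / n ^ 3) ≤ 10 / 3 := by
      rw [mul_div_assoc', div_le_iff₀ (by positivity)]
      nlinarith [mul_nonneg (sq_nonneg n) (sub_nonneg.2 hn3)]
    have h5 := mul_le_mul_of_nonneg_left (add_le_add h1 h2) hM0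
    have h6 := mul_le_mul_of_nonneg_right hM (zero_le_one.trans hlog1)
    nlinarith [mul_le_mul_of_nonneg_left hlog1 hn0.le]
  · have hMl := two_mul_card_edgeFinset_le_of_card (not_le.1 hl) hn2
    rw [← hn_def] at hMl
    -- $L = \log(n/2)$ minimizes $L + \frac n2 e^{-L}$.
    have hL : Real.exp (-(Real.log n - Real.log 2)) = 2 / n := by
      rw [neg_sub, Real.exp_sub, Real.exp_log hn0, Real.exp_log two_pos]
    refine (lintegral_activationTime_le hS hE (a := n / 2) (b := 0) (by positivity) le_rfl
      (sub_nonneg.2 hlogn) fun t => ?_).trans_lt ?_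
    · simpa using sum_inactiveProb_singleton_le hS hG hE t
    have hlog0 : 0 < Real.log n := by linarith
    rw [hL, ENNReal.ofReal_lt_ofReal_iff (by positivity)]
    have h1 : n / 2 * (2 / n) = 1 := by field_simp
    rw [h1]
    have h2 : 2 * (G.edgeFinset.card : ℝ) * (Real.log n + 307 / 1000) ≤
        (4 / 5 * n ^ 2 - 3 / 5 * n) * (Real.log n + 307 / 1000) :=
      mul_le_mul_of_nonneg_right hMl (by linarith)
    have h3 : 2 * (G.edgeFinset.card : ℝ) * (1 - Real.log 2) ≤
        2 * (G.edgeFinset.card : ℝ) * (307 / 1000) :=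
      mul_le_mul_of_nonneg_left (by linarith) hM0
    -- Here $307/1000$ bounds $1 - \log 2$ from above, and $\frac{307}{1250} =
    -- \frac45\cdot\frac{307}{1000}$.
    have h4 : 307 / 1250 * n ^ 2 + 1 < 1 / 5 * n ^ 2 * Real.log n + n := by
      rcases lt_or_ge (Fintype.card V) 4 with h | h
      · have h3 : n ≤ 3 := Nat.cast_le_ofNat.2 (Nat.le_of_lt_succ h)
        have : n ^ 2 * (69 / 100) ≤ n ^ 2 * Real.log n :=
          mul_le_mul_of_nonneg_left (by linarith) (sq_nonneg n)
        nlinarith [mul_nonneg (sub_nonneg.2 h3) (sub_nonneg.2 hn2')]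
      · have h4 : (4 : ℝ) ≤ n := Nat.ofNat_le_cast.2 h
        have h5 : Real.log 4 ≤ Real.log n := Real.log_le_log four_pos h4
        have h6 : Real.log 4 = 2 * Real.log 2 := by
          rw [show (4 : ℝ) = 2 ^ 2 by norm_num, Real.log_pow]
          norm_num
        have : n ^ 2 * (138 / 100) ≤ n ^ 2 * Real.log n :=
          mul_le_mul_of_nonneg_left (by linarith) (sq_nonneg n)
        nlinarith
    have h5 : 0 ≤ 3 / 5 * n * (Real.log n + 307 / 1000) := by positivity
    nlinarith
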